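/- Let $0\le k\le d-1$ and $0\le i\le \min(k,d-k)$ be integers. Let $G(d,k)$ be the Grassmannian of $k$-dimensional linear subspaces of $\mathbb R^d$ and $\nu^d_k$ its rotation invariant probability measure; for $A,B\in G(d,k)$ let $\langle A,B\rangle^2$ be the square of the determinant (with respect to orthonormal bases) of the orthogonal projection of $A$ onto $B$. Let $e_1,\dots,e_d$ be an orthonormal basis of $\mathbb R^d$, let $E$ be the span of $e_1,\dots,e_k$ and $F$ the span of $e_1,\dots,e_{k-i},e_{k+1},\dots,e_{k+i}$. Then the integral $$c^d_{k,i}=\int_{G(d,k)}\langle E,V\rangle^2\langle F,V\rangle^2\,\nu^d_k(dV)$$ does not depend on the choice of the orthonormal basis, and $$c^d_{k,i}=\frac{(k+1)(k+2)}{(i+1)(i+2)}\binom dk^{-1}\binom{d+2}{k}^{-1}.$$ -/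

import Mathlib

open MeasureTheory

noncomputable section

/-- Euclidean space `ℝ^d`. -/
abbrev Euc (d : ℕ) : Type := EuclideanSpace ℝ (Fin d)

/-- The Grassmann manifold `G(d,k)`: the `k`-dimensional linear subspaces of `ℝ^d`. -/
structure Grass (d k : ℕ) : Type where
  carrier : Submodule ℝ (Euc d)
  finrank_eq : Module.finrank ℝ carrier = k

namespace Grass

/-- The usual topology of `G(d,k)`: a subspace is identified with the orthogonal projection
onto it, and the operators carry the norm topology. -/
instance (d k : ℕ) : TopologicalSpace (Grass d k) :=
  TopologicalSpace.induced (fun V : Grass d k => V.carrier.starProjection) inferInstance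

instance (d k : ℕ) : MeasurableSpace (Grass d k) := borel _

instance (d k : ℕ) : BorelSpace (Grass d k) := ⟨rfl⟩

/-- The span of `k` orthonormal vectors, as a point of `G(d,k)`. -/
def span {d k : ℕ} (v : Fin k → Euc d) (hv : Orthonormal ℝ v) : Grass d k :=
  ⟨Submodule.span ℝ (Set.range v), by
    rw [finrank_span_eq_card hv.linearIndependent, Fintype.card_fin]⟩

/-- A chosen orthonormal basis of a subspace; see `absDet_eq` for the independence of
`absDet` from this choice. -/
def basis {d k : ℕ} (A : Grass d k) : OrthonormalBasis (Fin k) ℝ A.carrier :=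
  (stdOrthonormalBasis ℝ A.carrier).reindex (finCongr A.finrank_eq)

/-- `|⟨A,B⟩|`: the absolute value of the determinant (with respect to orthonormal bases) of the
orthogonal projection of `A` onto `B`. -/
def absDet {d k : ℕ} (A B : Grass d k) : ℝ :=
  |(LinearMap.toMatrix A.basis.toBasis B.basis.toBasis
    ((B.carrier.orthogonalProjectionOnto : Euc d →L[ℝ] B.carrier).toLinearMap ∘ₗ A.carrier.subtype)).det|

/-- `absDet` does not depend on the orthonormal bases. -/
theorem absDet_eq {d k : ℕ} (A B : Grass d k) (a : OrthonormalBasis (Fin k) ℝ A.carrier)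
    (b : OrthonormalBasis (Fin k) ℝ B.carrier) :
    absDet A B = |(LinearMap.toMatrix a.toBasis b.toBasis
      ((B.carrier.orthogonalProjectionOnto : Euc d →L[ℝ] B.carrier).toLinearMap ∘ₗ A.carrier.subtype)).det| := by
  unfold absDet
  rw [← basis_toMatrix_mul_linearMap_toMatrix_mul_basis_toMatrix A.basis.toBasis a.toBasis
    B.basis.toBasis b.toBasis, Matrix.det_mul, Matrix.det_mul, abs_mul, abs_mul]
  have h1 := B.basis.det_to_matrix_orthonormalBasis_real b
  have h2 := a.det_to_matrix_orthonormalBasis_real A.basis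
  rw [Module.Basis.det_apply] at h1 h2
  have e1 : |(B.basis.toBasis.toMatrix b.toBasis).det| = 1 := by
    rcases h1 with h | h <;> simp_all
  have e2 : |(a.toBasis.toMatrix A.basis.toBasis).det| = 1 := by
    rcases h2 with h | h <;> simp_all
  rw [e1, e2]; simp

end Grass

/-- The orthogonal group `O(d)`, a compact topological group. -/
abbrev OrthGroup (d : ℕ) : Type := Matrix.orthogonalGroup (Fin d) ℝ

instance (d : ℕ) : MeasurableSpace (OrthGroup d) := borel _

instance (d : ℕ) : BorelSpace (OrthGroup d) := ⟨rfl⟩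

instance (d : ℕ) : CompactSpace (OrthGroup d) := by
  refine isCompact_iff_compactSpace.mp (IsCompact.of_isClosed_subset
    (isCompact_univ_pi fun _ : Fin d => isCompact_univ_pi fun _ : Fin d =>
      isCompact_Icc (a := (-1 : ℝ)) (b := 1))
    (isClosed_unitary (R := Matrix (Fin d) (Fin d) ℝ)) ?_)
  intro U hU i _ j _
  exact abs_le.mp (by simpa using entry_norm_bound_of_unitary hU i j)

/-- The Haar probability measure on `O(d)`. -/
def orthHaar (d : ℕ) : Measure (OrthGroup d) := Measure.haarMeasure ⊤

instance (d : ℕ) : IsProbabilityMeasure (orthHaar d) :=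
  ⟨by
    have := Measure.haarMeasure_self (K₀ := (⊤ : TopologicalSpace.PositiveCompacts (OrthGroup d)))
    simpa [orthHaar] using this⟩

/-- An orthogonal matrix as a linear isometry of `ℝ^d`. -/
def orthIsometry {d : ℕ} (g : OrthGroup d) : Euc d ≃ₗᵢ[ℝ] Euc d :=
  Unitary.linearIsometryEquiv
    ⟨Matrix.toEuclideanCLM (𝕜 := ℝ) g.1, Unitary.map_mem (Matrix.toEuclideanCLM (𝕜 := ℝ)) g.2⟩

namespace Grass

/-- The action `V ↦ gV` of `O(d)` on `G(d,k)`. -/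
def rotate {d k : ℕ} (g : OrthGroup d) (V : Grass d k) : Grass d k :=
  ⟨V.carrier.map ((orthIsometry g).toLinearEquiv : Euc d →ₗ[ℝ] Euc d), by
    rw [LinearEquiv.finrank_map_eq]; exact V.finrank_eq⟩

/-- The span of the first `k` vectors of the canonical basis. -/
def base {d k : ℕ} (h : k ≤ d) : Grass d k :=
  span (EuclideanSpace.basisFun (Fin d) ℝ ∘ Fin.castLE h)
    ((EuclideanSpace.basisFun (Fin d) ℝ).orthonormal.comp _ (Fin.castLE_injective h))

/-- The invariant probability measure `ν_k^d` on `G(d,k)`: the law of `g V₀` for a fixed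
`V₀ ∈ G(d,k)` and a Haar distributed `g ∈ O(d)`. -/
def nu {d k : ℕ} (h : k ≤ d) : Measure (Grass d k) :=
  (orthHaar d).map (fun g => rotate g (base h))

theorem starProjection_rotate {d k : ℕ} (g : OrthGroup d) (V : Grass d k) :
    (rotate g V).carrier.starProjection = (Matrix.toEuclideanCLM (𝕜 := ℝ) g.1).comp
      (V.carrier.starProjection.comp (Matrix.toEuclideanCLM (𝕜 := ℝ) (star g).1)) := by
  ext1 x
  have hs : (orthIsometry g).symm x = Matrix.toEuclideanCLM (𝕜 := ℝ) (star g).1 x := by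
    rw [LinearIsometryEquiv.symm_apply_eq]
    change x = (Matrix.toEuclideanCLM (𝕜 := ℝ) g.1) (Matrix.toEuclideanCLM (𝕜 := ℝ) (star g).1 x)
    have : g.1 * (star g).1 = 1 := Unitary.mul_star_self_of_mem g.2
    rw [← mul_apply_eq_comp, ← map_mul, this, map_one]; rfl
  exact (Submodule.starProjection_map_apply (orthIsometry g) V.carrier x).trans (by rw [hs]; rfl)

theorem continuous_rotate {d k : ℕ} :
    Continuous (fun p : OrthGroup d × Grass d k => rotate p.1 p.2) := by
  refine continuous_induced_rng.mpr ?_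
  have hM : Continuous (Matrix.toEuclideanCLM (n := Fin d) (𝕜 := ℝ)) :=
    LinearMap.continuous_of_finiteDimensional
      ((Matrix.toEuclideanCLM (n := Fin d) (𝕜 := ℝ)).toAlgEquiv.toLinearMap)
  have hP : Continuous (fun V : Grass d k => V.carrier.starProjection) := continuous_induced_dom
  simp only [Function.comp_def, starProjection_rotate]
  exact (hM.comp (continuous_subtype_val.comp continuous_fst)).clm_comp
    ((hP.comp continuous_snd).clm_comp
      (hM.comp (continuous_subtype_val.comp (continuous_star.comp continuous_fst))))

theorem measurable_rotate_left {d k : ℕ} (V : Grass d k) :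
    Measurable (fun g : OrthGroup d => rotate g V) :=
  (continuous_rotate.comp (Continuous.prodMk_left V)).measurable

theorem measurable_rotate {d k : ℕ} (g : OrthGroup d) :
    Measurable (rotate g : Grass d k → Grass d k) :=
  (continuous_rotate.comp (Continuous.prodMk_right g)).measurable

instance {d k : ℕ} (h : k ≤ d) : IsProbabilityMeasure (nu h) :=
  Measure.isProbabilityMeasure_map (measurable_rotate_left _).aemeasurable

theorem rotate_rotate {d k : ℕ} (g g' : OrthGroup d) (V : Grass d k) :
    rotate g (rotate g' V) = rotate (g * g') V := by
  have h : orthIsometry (g * g') = orthIsometry g * orthIsometry g' := by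
    unfold orthIsometry
    rw [← map_mul]
    congr 1
    exact Subtype.ext (map_mul (Matrix.toEuclideanCLM (𝕜 := ℝ)) g.1 g'.1)
  unfold rotate
  congr 1
  rw [h, ← Submodule.map_comp]
  rfl

/-- `ν_k^d` is invariant under `O(d)`. -/
theorem map_rotate_nu {d k : ℕ} (h : k ≤ d) (g : OrthGroup d) :
    (nu h).map (rotate g) = nu h := by
  have hI : (orthHaar d).IsMulLeftInvariant := by unfold orthHaar; infer_instance
  have hc : rotate g ∘ (fun x => rotate x (base h)) =
      (fun x => rotate x (base h)) ∘ (fun x => g * x) := by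
    funext x
    exact rotate_rotate g x (base h)
  unfold nu
  rw [Measure.map_map (measurable_rotate g) (measurable_rotate_left _), hc,
    ← Measure.map_map (measurable_rotate_left _) (measurable_const_mul g),
    map_mul_left_eq_self]

/-- For an orthonormal basis `b` of `ℝ^d` and distinct indices `f 0, …, f (k-1)`, the subspace
spanned by the vectors `b (f 0), …, b (f (k-1))`. -/
def coord {d k : ℕ} (b : OrthonormalBasis (Fin d) ℝ (Euc d)) (f : Fin k ↪ Fin d) : Grass d k :=
  span (b ∘ f) (b.orthonormal.comp f f.injective)

end Grass

/-- The (zero-based) indices `0, …, k-i-1, k, …, k+i-1`. -/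
def shiftEmb {d k i : ℕ} (h : k + i ≤ d) : Fin k ↪ Fin d where
  toFun j := if (j : ℕ) + i < k then ⟨j, by omega⟩ else ⟨j + i, by omega⟩
  inj' := by
    intro x y hxy
    ext
    dsimp only at hxy
    split_ifs at hxy <;> simp only [Fin.mk.injEq] at hxy <;> omega

/-- `c^d_{k,i} = ∫ ⟨E,V⟩² ⟨F,V⟩² ν_k^d(dV)`, where `E` is spanned by `e_1, …, e_k` and `F` by
`e_1, …, e_{k-i}, e_{k+1}, …, e_{k+i}`, for an orthonormal basis `e_1, …, e_d` of `ℝ^d`. -/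
def grassConst {d k i : ℕ} (h : k + i ≤ d) (e : OrthonormalBasis (Fin d) ℝ (Euc d)) : ℝ :=
  ∫ V : Grass d k,
    (Grass.coord e (Fin.castLEEmb (show k ≤ d by omega))).absDet V ^ 2
      * (Grass.coord e (shiftEmb h)).absDet V ^ 2 ∂(Grass.nu (show k ≤ d by omega))

end

noncomputable section

open Matrix Equiv

/-! Write p_f for the minor on the rows f of the d × k matrix formed by the first k columns of a
Haar distributed g in O(d). The integral is E[p_f² p_h²], where f and h list the indices spanning E
and F; left invariance of Haar measure absorbs the coordinate matrix of the basis, so the basis is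
irrelevant (`grassConst_eq_minorMoment`).

Let n be the number of indices of h outside f. For an index f r missing from h and an index h s
missing from f, let f' and h' arise by exchanging the two, and put B = E[p_f p_h p_f' p_h']. The
Plücker relation multiplied by p_f p_h leaves only the n exchanges with indices of h outside f, all
of the same mean, so E[p_f² p_h²] = n B (`minorMoment_eq_card_mul`). Invariance under an orthogonal
map mixing the coordinates f r and h s gives E[p_f² p_h'²] = E[p_f² p_h²] + 2B
(`minorMoment_update`). As h' has one index fewer outside f, the values a_n satisfy a_{n-1} = a_n
(n+2)/n, whence a_n = 2 a_0 / ((n+1)(n+2)) (`minorMoment_eq`).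

The value a_0 comes from normalization (`minorMoment_self`): by Cauchy–Binet the squared minors sum
to 1, so E[p_f²] is the inverse of C(d,k); it is also the sum of E[p_f² p_J²] over all J, which
Vandermonde's identity evaluates in terms of a_0. -/

/-- The `k × k` minor of a `d × k` matrix on the rows `f 0, …, f (k-1)`. -/
def rowMinor {d k : ℕ} (X : Matrix (Fin d) (Fin k) ℝ) (f : Fin k → Fin d) : ℝ :=
  (X.submatrix f id).det

/-! ### Minors: exchange relation and behaviour under orthogonal maps -/

section RowMinor

variable {d k : ℕ} (X : Matrix (Fin d) (Fin k) ℝ)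

theorem continuous_rowMinor (f : Fin k → Fin d) :
    Continuous fun X : Matrix (Fin d) (Fin k) ℝ => rowMinor X f :=
  (continuous_id.matrix_submatrix f id).matrix_det

theorem rowMinor_eq_zero {f : Fin k → Fin d} (hf : ¬ Function.Injective f) :
    rowMinor X f = 0 := by
  simp only [Function.Injective, not_forall] at hf
  obtain ⟨i, j, hij, hne⟩ := hf
  exact det_zero_of_row_eq hne (by ext c; simp [hij])

theorem rowMinor_comp_perm (f : Fin k → Fin d) (τ : Perm (Fin k)) :
    rowMinor X (f ∘ τ) = ((Perm.sign τ : ℤ) : ℝ) * rowMinor X f := by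
  have := det_permute τ (X.submatrix f id)
  simpa [rowMinor, Matrix.submatrix_submatrix] using this

theorem submatrix_update (f : Fin k → Fin d) (r : Fin k) (b : Fin d) :
    X.submatrix (Function.update f r b) id = (X.submatrix f id).updateRow r (X b) := by
  ext i j
  by_cases h : i = r
  · subst h; simp
  · simp [h]

theorem rowMinor_sq_eq_of_range_subset {f h : Fin k → Fin d}
    (hh : Function.Injective h) (H : ∀ s, h s ∈ Set.range f) :
    rowMinor X h ^ 2 = rowMinor X f ^ 2 := by
  choose τ hτ using H
  have hinj : Function.Injective τ := fun x y hxy => hh (by rw [← hτ, ← hτ, hxy])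
  let e : Perm (Fin k) := Equiv.ofBijective τ (Finite.injective_iff_bijective.mp hinj)
  have he : h = f ∘ e := funext fun s => (hτ s).symm
  rw [he, rowMinor_comp_perm, mul_pow]
  rcases Int.units_eq_one_or (Perm.sign e) with h1 | h1 <;> simp [h1]

/-- The Plücker exchange relation. -/
theorem rowMinor_mul_rowMinor (f h : Fin k → Fin d) (r : Fin k) :
    rowMinor X f * rowMinor X h =
      ∑ s, rowMinor X (Function.update f r (h s)) * rowMinor X (Function.update h s (f r)) := by
  -- Cramer's rule writes p_h times the row X (f r) as a combination of the rows X (h s), even if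
  -- p_h = 0. Putting this combination in row r of the minor f gives the relation by linearity.
  have hc := mulVec_cramer (X.submatrix h id)ᵀ (X (f r))
  have hlin := congrArg (cramer (X.submatrix f id)ᵀ) hc
  have hsum : (X.submatrix h id)ᵀ *ᵥ cramer (X.submatrix h id)ᵀ (X (f r)) =
      ∑ s, rowMinor X (Function.update h s (f r)) • X (h s) := by
    ext c
    simp only [mulVec, dotProduct, Finset.sum_apply, Pi.smul_apply, smul_eq_mul,
      cramer_transpose_apply, rowMinor, submatrix_update, transpose_apply, submatrix_apply, id]
    exact Finset.sum_congr rfl fun s _ => mul_comm _ _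
  rw [hsum, map_sum, map_smul] at hlin
  have hr := congrFun hlin r
  simp only [map_smul, Finset.sum_apply, Pi.smul_apply, smul_eq_mul, cramer_transpose_apply,
    ← submatrix_update, det_transpose, Function.update_eq_self] at hr
  simp only [rowMinor]
  rw [mul_comm, ← hr]
  exact Finset.sum_congr rfl fun s _ => mul_comm _ _

theorem rowMinor_permMatrix_mul (σ : Perm (Fin d)) (f : Fin k → Fin d) :
    rowMinor ((1 : Matrix (Fin d) (Fin d) ℝ).submatrix σ id * X) f = rowMinor X (σ ∘ f) := by
  have : ((1 : Matrix (Fin d) (Fin d) ℝ).submatrix σ id * X).submatrix f id =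
      X.submatrix (σ ∘ f) id := by
    ext i j
    simp [mul_apply, one_apply]
  rw [rowMinor, this, rowMinor]

theorem rowMinor_diagonal_mul (v : Fin d → ℝ) (f : Fin k → Fin d) :
    rowMinor (diagonal v * X) f = (∏ j, v (f j)) * rowMinor X f := by
  have : (diagonal v * X).submatrix f id = diagonal (v ∘ f) * X.submatrix f id := by
    ext i j; simp [diagonal_mul]
  rw [rowMinor, this, det_mul, det_diagonal]
  rfl

theorem rowMinor_reflect_of_mem {f : Fin k → Fin d} (hf : Function.Injective f) (r : Fin k) :
    rowMinor (diagonal (Function.update (1 : Fin d → ℝ) (f r) (-1)) * X) f = - rowMinor X f := by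
  rw [rowMinor_diagonal_mul, Finset.prod_eq_single r]
  · simp
  · intro j _ hj
    rw [Function.update_of_ne (hf.ne hj)]; rfl
  · simp

theorem rowMinor_reflect_of_notMem {f : Fin k → Fin d} {a : Fin d} (h : a ∉ Set.range f) :
    rowMinor (diagonal (Function.update (1 : Fin d → ℝ) a (-1)) * X) f = rowMinor X f := by
  rw [rowMinor_diagonal_mul, Finset.prod_eq_one, one_mul]
  intro j _
  rw [Function.update_of_ne (fun hj => h ⟨j, hj⟩)]; rfl

/-- The reflection of `ℝ^d` in the hyperplane orthogonal to `e_a - 2 e_b`. -/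
def planeReflection (a b : Fin d) : Matrix (Fin d) (Fin d) ℝ :=
  1 - (2 / 5 : ℝ) • vecMulVec (Pi.single a 1 - (2 : ℝ) • Pi.single b 1)
    (Pi.single a 1 - (2 : ℝ) • Pi.single b 1)

theorem planeReflection_mem {a b : Fin d} (hab : a ≠ b) :
    planeReflection a b ∈ orthogonalGroup (Fin d) ℝ := by
  rw [mem_orthogonalGroup_iff]
  set v : Fin d → ℝ := Pi.single a 1 - (2 : ℝ) • Pi.single b 1 with hv
  have hvv : v ⬝ᵥ v = 5 := by
    simp [hv, hab, hab.symm, dotProduct_sub]; norm_num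
  have hT : (planeReflection a b)ᵀ = planeReflection a b := by
    rw [planeReflection, ← hv, transpose_sub, transpose_smul, transpose_vecMulVec, transpose_one]
  rw [hT, planeReflection, ← hv, sub_mul, mul_sub, mul_sub, one_mul, mul_one, smul_mul_smul_comm,
    vecMulVec_mul_vecMulVec, hvv, one_mul, vecMulVec_smul, smul_smul]
  module

/-- Row f r of the reflection has entries 3/5 and 4/5 at f r and b. Row b is the only other row that
changes, and it does not enter the minor. -/
theorem rowMinor_planeReflection_mul {f : Fin k → Fin d} (hf : Function.Injective f) (r : Fin k)
    {b : Fin d} (hb : b ∉ Set.range f) :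
    rowMinor (planeReflection (f r) b * X) f =
      3 / 5 * rowMinor X f + 4 / 5 * rowMinor X (Function.update f r b) := by
  have hne : ∀ j, f j ≠ b := fun j h => hb ⟨j, h⟩
  have key : (planeReflection (f r) b * X).submatrix f id =
      (X.submatrix f id).updateRow r ((3 / 5 : ℝ) • X (f r) + (4 / 5 : ℝ) • X b) := by
    rw [planeReflection, Matrix.sub_mul, Matrix.one_mul, Matrix.smul_mul, vecMulVec_mul,
      sub_vecMul, smul_vecMul, single_one_vecMul, single_one_vecMul]
    ext i j
    by_cases h : i = r
    · subst h
      simp [vecMulVec_apply, hne]; ring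
    · simp [vecMulVec_apply, hne, h, hf.ne h]
  rw [rowMinor, key, det_updateRow_add, det_updateRow_smul, det_updateRow_smul,
    ← submatrix_update, ← submatrix_update, Function.update_eq_self]
  rfl

end RowMinor

/-! ### Random orthonormal frames and their invariance -/

/-- The first `k` columns of an orthogonal matrix. -/
def frame {d k : ℕ} (hk : k ≤ d) (g : OrthGroup d) : Matrix (Fin d) (Fin k) ℝ :=
  g.1.submatrix id (Fin.castLE hk)

/-- The mean of `F` over random orthonormal `k`-frames of `ℝ^d`. -/
def frameMean {d k : ℕ} (hk : k ≤ d) (F : Matrix (Fin d) (Fin k) ℝ → ℝ) : ℝ :=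
  ∫ g, F (frame hk g) ∂orthHaar d

theorem injective_update {α β : Type*} [DecidableEq α] {h : α → β} (hh : Function.Injective h)
    (s : α) {a : β} (ha : a ∉ Set.range h) : Function.Injective (Function.update h s a) := by
  intro i j hij
  by_cases hi : i = s <;> by_cases hj : j = s
  · rw [hi, hj]
  · subst hi; rw [Function.update_self, Function.update_of_ne hj] at hij
    exact (ha ⟨j, hij.symm⟩).elim
  · subst hj; rw [Function.update_self, Function.update_of_ne hi] at hij
    exact (ha ⟨i, hij⟩).elim
  · rw [Function.update_of_ne hi, Function.update_of_ne hj] at hij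
    exact hh hij

section FrameMean

variable {d k : ℕ} (hk : k ≤ d)

theorem continuous_frame : Continuous (frame hk : OrthGroup d → _) :=
  continuous_subtype_val.matrix_submatrix _ _

variable {F G : Matrix (Fin d) (Fin k) ℝ → ℝ}

theorem integrable_frame (hF : Continuous F) :
    Integrable (fun g => F (frame hk g)) (orthHaar d) :=
  (hF.comp (continuous_frame hk)).integrable_of_hasCompactSupport
    (HasCompactSupport.of_compactSpace _)

theorem frameMean_add (hF : Continuous F) (hG : Continuous G) :
    frameMean hk (fun X => F X + G X) = frameMean hk F + frameMean hk G :=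
  integral_add (integrable_frame hk hF) (integrable_frame hk hG)

theorem frameMean_const_mul (c : ℝ) :
    frameMean hk (fun X => c * F X) = c * frameMean hk F :=
  integral_const_mul _ _

theorem frameMean_sum {ι : Type*} (s : Finset ι) {F : ι → Matrix (Fin d) (Fin k) ℝ → ℝ}
    (hF : ∀ i ∈ s, Continuous (F i)) :
    frameMean hk (fun X => ∑ i ∈ s, F i X) = ∑ i ∈ s, frameMean hk (F i) :=
  integral_finsetSum _ fun i hi => integrable_frame hk (hF i hi)

/-- Multiplying the frame of g by T gives the frame of T g, so this is left invariance of Haar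
measure. It is the only property of the distribution used to relate the moments. -/
theorem frameMean_mul {T : Matrix (Fin d) (Fin d) ℝ} (hT : T ∈ orthogonalGroup (Fin d) ℝ)
    (F : Matrix (Fin d) (Fin k) ℝ → ℝ) :
    frameMean hk (fun X => F (T * X)) = frameMean hk F := by
  have hI : (orthHaar d).IsMulLeftInvariant := by unfold orthHaar; infer_instance
  have : ∀ g : OrthGroup d, T * frame hk g = frame hk ((⟨T, hT⟩ : OrthGroup d) * g) := by
    intro g
    ext i j
    simp [frame, mul_apply]
  simp only [frameMean, this]
  exact integral_mul_left_eq_self (fun g => F (frame hk g)) _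

theorem permMatrix_mem_orthogonalGroup (σ : Perm (Fin d)) :
    (1 : Matrix (Fin d) (Fin d) ℝ).submatrix σ id ∈ orthogonalGroup (Fin d) ℝ := by
  rw [mem_orthogonalGroup_iff, transpose_submatrix, transpose_one]
  ext i j
  simp [mul_apply, one_apply, eq_comm]

theorem reflect_mem_orthogonalGroup (a : Fin d) :
    diagonal (Function.update (1 : Fin d → ℝ) a (-1)) ∈ orthogonalGroup (Fin d) ℝ := by
  rw [mem_orthogonalGroup_iff, diagonal_transpose, diagonal_mul_diagonal, ← diagonal_one]
  congr 1
  ext i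
  by_cases h : i = a
  · subst h; simp
  · simp [h]

/-! ### Recursion for the moments of minors -/

/-- The mean of the product of two squared minors of a random frame. -/
def minorMoment (f h : Fin k → Fin d) : ℝ :=
  frameMean hk fun X => rowMinor X f ^ 2 * rowMinor X h ^ 2

theorem minorMoment_perm (σ : Perm (Fin d)) (f h : Fin k → Fin d) :
    minorMoment hk (σ ∘ f) (σ ∘ h) = minorMoment hk f h := by
  have := frameMean_mul hk (permMatrix_mem_orthogonalGroup σ)
    (fun X => rowMinor X f ^ 2 * rowMinor X h ^ 2)
  simp only [rowMinor_permMatrix_mul] at this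
  exact this

/-- The mixed fourth moment of minors which occurs in the exchange relation. -/
def exchangeMoment (f h : Fin k → Fin d) (r s : Fin k) : ℝ :=
  frameMean hk fun X => rowMinor X f * rowMinor X h *
    (rowMinor X (Function.update f r (h s)) * rowMinor X (Function.update h s (f r)))

variable {f h : Fin k → Fin d}

/-- Swapping the coordinates h s and h t fixes f and turns one exchange into the other. The minors
of h and of the exchanged h both acquire the sign of the transposition, so the signs cancel. -/
theorem exchangeMoment_eq (hh : Function.Injective h) (r : Fin k)
    {s t : Fin k} (hs : h s ∉ Set.range f) (ht : h t ∉ Set.range f) :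
    exchangeMoment hk f h r s = exchangeMoment hk f h r t := by
  have hf : ∀ j, swap (h s) (h t) (f j) = f j := fun j =>
    swap_apply_of_ne_of_ne (fun e => hs ⟨j, e⟩) (fun e => ht ⟨j, e⟩)
  have hcomm : ∀ j, swap (h s) (h t) (h j) = h (swap s t j) := fun j => by
    rw [hh.swap_apply]
  have e1 : swap (h s) (h t) ∘ f = f := funext hf
  have e2 : swap (h s) (h t) ∘ h = h ∘ swap s t := funext hcomm
  have e3 : swap (h s) (h t) ∘ Function.update f r (h s) = Function.update f r (h t) := by
    rw [Function.comp_update, e1, swap_apply_left]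
  have e4 : swap (h s) (h t) ∘ Function.update h s (f r) =
      Function.update h t (f r) ∘ swap s t := by
    rw [Function.comp_update, e2, hf]
    ext j
    by_cases hj : j = s
    · subst hj; simp
    · have : swap s t j ≠ t := fun e => hj (by simpa using congrArg (swap s t) e)
      simp [hj, this]
  have := frameMean_mul hk (permMatrix_mem_orthogonalGroup (swap (h s) (h t)))
    (fun X => rowMinor X f * rowMinor X h *
      (rowMinor X (Function.update f r (h s)) * rowMinor X (Function.update h s (f r))))
  simp only [rowMinor_permMatrix_mul, e1, e2, e3, e4, rowMinor_comp_perm] at this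
  rw [exchangeMoment, ← this, exchangeMoment]
  congr 1
  ext X
  rcases Int.units_eq_one_or (Perm.sign (swap s t)) with h1 | h1 <;> simp [h1]

theorem minorMoment_eq_card_mul (hh : Function.Injective h) {r s : Fin k}
    (hr : f r ∉ Set.range h) (hs : h s ∉ Set.range f) :
    minorMoment hk f h =
      (Finset.univ.filter fun t => h t ∉ Set.range f).card * exchangeMoment hk f h r s := by
  have key : ∀ X : Matrix (Fin d) (Fin k) ℝ, rowMinor X f ^ 2 * rowMinor X h ^ 2 =
      ∑ t ∈ Finset.univ.filter fun t => h t ∉ Set.range f, rowMinor X f * rowMinor X h *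
        (rowMinor X (Function.update f r (h t)) * rowMinor X (Function.update h t (f r))) := by
    intro X
    rw [← Finset.mul_sum, Finset.sum_filter_of_ne, ← rowMinor_mul_rowMinor]
    · ring
    -- If h t = f j, then j ≠ r, and replacing f r by h t repeats a row, so the term vanishes.
    · rintro t - ht ⟨j, hj⟩
      refine ht ?_
      rw [rowMinor_eq_zero, zero_mul]
      intro hinj
      have hjr : j ≠ r := fun e => hr ⟨t, by rw [← hj, e]⟩
      exact hjr (hinj (by simp [hjr, hj]))
  unfold minorMoment
  simp only [key]
  rw [frameMean_sum]
  · rw [Finset.sum_congr rfl (g := fun _ => exchangeMoment hk f h r s), Finset.sum_const,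
      nsmul_eq_mul]
    intro t ht
    exact exchangeMoment_eq hk hh r (Finset.mem_filter.mp ht).2 hs
  · intro t _
    have := fun f => continuous_rowMinor (d := d) (k := k) f
    fun_prop

/-- With f', h' the exchanged index families, the plane reflection sends p_f to (3p_f + 4p_f')/5 and
p_h' to (3p_h' + 4p_h)/5. Expanding the invariant mean of p_f² p_h'² gives a linear relation between
the moments. The exchange moment survives because both coefficients 3/5 and 4/5 are nonzero. -/
theorem minorMoment_update (hf : Function.Injective f) (hh : Function.Injective h) {r s : Fin k}
    (hr : f r ∉ Set.range h) (hs : h s ∉ Set.range f) :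
    minorMoment hk f (Function.update h s (f r)) =
      minorMoment hk f h + 2 * exchangeMoment hk f h r s := by
  have hne : f r ≠ h s := fun e => hs ⟨r, e⟩
  set y : Fin k → Fin d := Function.update f r (h s) with hy
  set z : Fin k → Fin d := Function.update h s (f r) with hz
  have hzs : z s = f r := by simp [hz]
  have hzinj : Function.Injective z := injective_update hh s hr
  have hzb : h s ∉ Set.range z := by
    rintro ⟨j, hj⟩
    by_cases hjs : j = s
    · subst hjs; exact hne (hzs.symm.trans hj)
    · rw [hz, Function.update_of_ne hjs] at hj; exact hjs (hh hj)
  have hya : f r ∉ Set.range y := by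
    rintro ⟨j, hj⟩
    by_cases hjr : j = r
    · subst hjr; rw [hy, Function.update_self] at hj; exact hne hj.symm
    · rw [hy, Function.update_of_ne hjr] at hj; exact hjr (hf hj)
  have hzw : Function.update z s (h s) = h := by simp [hz]
  have s1 : swap (f r) (h s) ∘ f = y := by
    ext j
    by_cases hjr : j = r
    · subst hjr; simp [hy]
    · rw [Function.comp_apply, swap_apply_of_ne_of_ne (hf.ne hjr) (fun e => hs ⟨j, e⟩), hy,
        Function.update_of_ne hjr]
  have s2 : swap (f r) (h s) ∘ h = z := by
    ext j
    by_cases hjs : j = s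
    · subst hjs; simp [hz]
    · rw [Function.comp_apply, swap_apply_of_ne_of_ne (fun e => hr ⟨j, e⟩) (hh.ne hjs), hz,
        Function.update_of_ne hjs]
  have s3 : swap (f r) (h s) ∘ z = h := by
    rw [← s2]; ext j; simp
  have q1 : minorMoment hk y h = minorMoment hk f z := by
    rw [← minorMoment_perm hk (swap (f r) (h s)) f z, s1, s3]
  have q2 : minorMoment hk y z = minorMoment hk f h := by
    rw [← minorMoment_perm hk (swap (f r) (h s)) f h, s1, s2]
  have hrot := frameMean_mul hk (planeReflection_mem hne)
    (fun X => rowMinor X f ^ 2 * rowMinor X z ^ 2)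
  have hz' : ∀ X : Matrix (Fin d) (Fin k) ℝ, rowMinor (planeReflection (f r) (h s) * X) z =
      3 / 5 * rowMinor X z + 4 / 5 * rowMinor X h := fun X => by
    have := rowMinor_planeReflection_mul X hzinj s hzb
    rwa [hzs, hzw] at this
  simp only [rowMinor_planeReflection_mul _ hf r hs, hz', ← hy] at hrot
  -- Changing the sign of coordinate f r negates the minors f and z but not y and h. Adding the two
  -- expressions removes the terms of odd degree in the pair f, z.
  have hrefl := frameMean_mul hk (reflect_mem_orthogonalGroup (f r))
    (fun X => (3 / 5 * rowMinor X f + 4 / 5 * rowMinor X y) ^ 2 *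
      (3 / 5 * rowMinor X z + 4 / 5 * rowMinor X h) ^ 2)
  have hz'' : ∀ X : Matrix (Fin d) (Fin k) ℝ,
      rowMinor (diagonal (Function.update (1 : Fin d → ℝ) (f r) (-1)) * X) z = - rowMinor X z :=
    fun X => by
      have := rowMinor_reflect_of_mem X hzinj s
      rwa [hzs] at this
  simp only [rowMinor_reflect_of_mem _ hf r, rowMinor_reflect_of_notMem _ hr,
    rowMinor_reflect_of_notMem _ hya, hz''] at hrefl
  have hcont := fun f => continuous_rowMinor (d := d) (k := k) f
  have hsum : frameMean hk (fun X =>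
        (3 / 5 * -rowMinor X f + 4 / 5 * rowMinor X y) ^ 2 *
          (3 / 5 * -rowMinor X z + 4 / 5 * rowMinor X h) ^ 2) +
      frameMean hk (fun X => (3 / 5 * rowMinor X f + 4 / 5 * rowMinor X y) ^ 2 *
          (3 / 5 * rowMinor X z + 4 / 5 * rowMinor X h) ^ 2) =
      162 / 625 * minorMoment hk f z + 512 / 625 * minorMoment hk y h +
        288 / 625 * minorMoment hk f h + 288 / 625 * minorMoment hk y z +
        1152 / 625 * exchangeMoment hk f h r s := by
    simp only [minorMoment, exchangeMoment, ← frameMean_const_mul]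
    rw [← frameMean_add, ← frameMean_add, ← frameMean_add, ← frameMean_add, ← frameMean_add]
    · congr 1
      ext X
      rw [← hy, ← hz]
      ring
    all_goals fun_prop
  rw [hrefl, hrot, q1, q2] at hsum
  change minorMoment hk f z + minorMoment hk f z = _ at hsum
  linarith

theorem minorMoment_eq (hf : Function.Injective f) (hh : Function.Injective h) :
    minorMoment hk f h = 2 * minorMoment hk f f /
      (((Finset.univ.filter fun t => h t ∉ Set.range f).card + 1) *
        ((Finset.univ.filter fun t => h t ∉ Set.range f).card + 2)) := by
  induction hn : (Finset.univ.filter fun t => h t ∉ Set.range f).card generalizing h with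
  | zero =>
    have : ∀ t, h t ∈ Set.range f := by
      simpa [Finset.filter_eq_empty_iff] using hn
    simp only [minorMoment, rowMinor_sq_eq_of_range_subset _ hh this]
    norm_num
  | succ n ih =>
    obtain ⟨s, hs⟩ : ∃ s, h s ∉ Set.range f := by
      have : 0 < (Finset.univ.filter fun t => h t ∉ Set.range f).card := by omega
      obtain ⟨s, hs⟩ := Finset.card_pos.mp this
      exact ⟨s, (Finset.mem_filter.mp hs).2⟩
    -- Both ranges have k elements, so neither can be properly contained in the other.
    obtain ⟨r, hr⟩ : ∃ r, f r ∉ Set.range h := by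
      by_contra! hc
      have h1 : Finset.univ.image f ⊆ Finset.univ.image h := by
        intro x hx
        obtain ⟨j, -, rfl⟩ := Finset.mem_image.mp hx
        obtain ⟨t, ht⟩ := hc j
        exact Finset.mem_image.mpr ⟨t, Finset.mem_univ _, ht⟩
      have h2 := Finset.eq_of_subset_of_card_le h1 (by
        rw [Finset.card_image_of_injective _ hf, Finset.card_image_of_injective _ hh])
      have h3 : h s ∈ Finset.univ.image f := by rw [h2]; simp
      exact hs (by simpa using h3)
    have hz := injective_update hh s hr
    have hcard : (Finset.univ.filter fun t => Function.update h s (f r) t ∉ Set.range f) =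
        (Finset.univ.filter fun t => h t ∉ Set.range f).erase s := by
      ext t
      by_cases ht : t = s
      · subst ht; simp
      · simp [ht]
    have hrec := ih hz (by rw [hcard, Finset.card_erase_of_mem (by simpa using hs), hn]; rfl)
    rw [minorMoment_update hk hf hh hr hs] at hrec
    have hex := minorMoment_eq_card_mul hk hh hr hs
    rw [hn] at hex
    push_cast at hex ⊢
    have hp1 : (n : ℝ) + 1 ≠ 0 := by positivity
    have hp2 : (n : ℝ) + 2 ≠ 0 := by positivity
    rw [eq_div_iff (mul_ne_zero hp1 hp2)] at hrec
    rw [eq_div_iff (by positivity)]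
    rw [hex] at hrec ⊢
    linear_combination hrec

end FrameMean

/-! ### From subspaces to minors -/

namespace Grass

variable {d k : ℕ}

theorem exists_orthonormalBasis (A : Grass d k) {v : Fin k → Euc d} (hv : Orthonormal ℝ v)
    (hA : ∀ j, v j ∈ A.carrier) :
    ∃ a : OrthonormalBasis (Fin k) ℝ A.carrier, ∀ j, (a j : Euc d) = v j := by
  have ho : Orthonormal ℝ fun j => (⟨v j, hA j⟩ : A.carrier) := by
    have := hv.codRestrict A.carrier hA
    exact this
  have hs := ho.linearIndependent.span_eq_top_of_card_eq_finrank'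
    (by rw [Fintype.card_fin, A.finrank_eq])
  exact ⟨OrthonormalBasis.mk ho hs.ge, fun j => by simp⟩

theorem absDet_eq_det_inner (A B : Grass d k) {v w : Fin k → Euc d} (hv : Orthonormal ℝ v)
    (hA : ∀ j, v j ∈ A.carrier) (hw : Orthonormal ℝ w) (hB : ∀ j, w j ∈ B.carrier) :
    absDet A B = |(Matrix.of fun j c => inner ℝ (v j) (w c)).det| := by
  obtain ⟨a, ha⟩ := A.exists_orthonormalBasis hv hA
  obtain ⟨b, hb⟩ := B.exists_orthonormalBasis hw hB
  rw [absDet_eq A B a b, ← det_transpose]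
  congr 2
  ext j c
  rw [transpose_apply, LinearMap.toMatrix_apply, OrthonormalBasis.coe_toBasis_repr_apply,
    OrthonormalBasis.repr_apply_apply, of_apply, real_inner_comm, ← hb, ← ha]
  simp

/-- The square is a Gram determinant, which involves B only through its projection. This removes the
chosen basis of B, which need not vary continuously, and yields continuity in B. -/
theorem absDet_sq_eq_det (A B : Grass d k) {v : Fin k → Euc d} (hv : Orthonormal ℝ v)
    (hA : ∀ j, v j ∈ A.carrier) :
    absDet A B ^ 2 = (Matrix.of fun i j => inner ℝ (v i) (B.carrier.starProjection (v j))).det := by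
  have hw : Orthonormal ℝ fun c => (B.basis c : Euc d) :=
    B.basis.orthonormal.comp_linearIsometry B.carrier.subtypeₗᵢ
  rw [absDet_eq_det_inner A B hv hA hw fun c => (B.basis c).2, sq_abs, sq]
  nth_rewrite 2 [← det_transpose]
  rw [← det_mul]
  congr 1
  ext i j
  rw [of_apply, ← Submodule.coe_orthogonalProjectionOnto_apply]
  nth_rewrite 1 [← B.basis.sum_repr (B.carrier.orthogonalProjectionOnto (v j))]
  simp [mul_apply, OrthonormalBasis.repr_apply_apply, inner_sum, inner_smul_right, mul_comm,
    real_inner_comm]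

theorem continuous_absDet_sq (A : Grass d k) : Continuous fun B => absDet A B ^ 2 := by
  have hv : Orthonormal ℝ fun c => (A.basis c : Euc d) :=
    A.basis.orthonormal.comp_linearIsometry A.carrier.subtypeₗᵢ
  simp only [fun B => absDet_sq_eq_det A B hv fun c => (A.basis c).2]
  have hP : Continuous (fun V : Grass d k => V.carrier.starProjection) := continuous_induced_dom
  refine Continuous.matrix_det (continuous_matrix fun i j => ?_)
  exact continuous_const.inner (hP.clm_apply continuous_const)

/-- The coordinates of an orthonormal basis form an orthogonal matrix. -/
theorem coordinates_mem_orthogonalGroup (e : OrthonormalBasis (Fin d) ℝ (Euc d)) :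
    (Matrix.of fun i l => e i l) ∈ orthogonalGroup (Fin d) ℝ := by
  rw [mem_orthogonalGroup_iff]
  ext i j
  have := orthonormal_iff_ite.mp e.orthonormal j i
  rw [PiLp.inner_apply] at this
  simpa [mul_apply, one_apply, eq_comm] using this

theorem absDet_coord_rotate_base (hk : k ≤ d) (e : OrthonormalBasis (Fin d) ℝ (Euc d))
    (f : Fin k ↪ Fin d) (g : OrthGroup d) :
    (coord e f).absDet (rotate g (base hk)) ^ 2 =
      rowMinor ((Matrix.of fun i l => e i l) * frame hk g) f ^ 2 := by
  have hw : Orthonormal ℝ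
      (orthIsometry g ∘ EuclideanSpace.basisFun (Fin d) ℝ ∘ Fin.castLE hk) :=
    ((EuclideanSpace.basisFun (Fin d) ℝ).orthonormal.comp _
      (Fin.castLE_injective hk)).comp_linearIsometry (orthIsometry g).toLinearIsometry
  rw [absDet_eq_det_inner _ _ (e.orthonormal.comp f f.injective)
    (fun j => Submodule.subset_span (Set.mem_range_self j)) hw
    (fun c => Submodule.mem_map_of_mem (Submodule.subset_span (Set.mem_range_self c))), sq_abs, rowMinor]
  congr 2
  ext j c
  have : ∀ l, orthIsometry g (EuclideanSpace.basisFun (Fin d) ℝ (Fin.castLE hk c)) l =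
      g.1 l (Fin.castLE hk c) := fun l => by
    change (Matrix.toEuclideanCLM (𝕜 := ℝ) g.1) _ l = _
    simp
  simp [PiLp.inner_apply, mul_apply, frame, -EuclideanSpace.basisFun_apply, this, mul_comm]

end Grass

theorem grassConst_eq_minorMoment {d k i : ℕ} (hid : k + i ≤ d)
    (e : OrthonormalBasis (Fin d) ℝ (Euc d)) :
    grassConst hid e = minorMoment (show k ≤ d by omega)
      (Fin.castLEEmb (show k ≤ d by omega)) (shiftEmb hid) := by
  have hk : k ≤ d := by omega
  rw [grassConst, Grass.nu, integral_map (Grass.measurable_rotate_left _).aemeasurable]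
  · simp only [Grass.absDet_coord_rotate_base]
    exact frameMean_mul hk (Grass.coordinates_mem_orthogonalGroup e)
      (fun X => rowMinor X (Fin.castLEEmb hk) ^ 2 * rowMinor X (shiftEmb hid) ^ 2)
  · exact ((Grass.continuous_absDet_sq _).mul
      (Grass.continuous_absDet_sq _)).measurable.aestronglyMeasurable

/-! ### Normalization: Cauchy–Binet and Vandermonde -/

/-- The Cauchy–Binet formula for `Xᵀ X`. -/
theorem sum_rowMinor_sq {d k : ℕ} (X : Matrix (Fin d) (Fin k) ℝ)
    (ε : Finset (Fin d) → Fin k → Fin d)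
    (hε : ∀ J ∈ Finset.powersetCard k Finset.univ,
      Function.Injective (ε J) ∧ Finset.univ.image (ε J) = J) :
    ∑ J ∈ Finset.powersetCard k Finset.univ, rowMinor X (ε J) ^ 2 = (Xᵀ * X).det := by
  have h1 : (Xᵀ * X).det = ∑ h : Fin k → Fin d, (∏ j, X (h j) j) * rowMinor X h := by
    have hrow : Xᵀ * X = fun j => ∑ l, X l j • X l := by
      ext j c
      simp [mul_apply]
    have := (detRowAlternating (n := Fin k) (R := ℝ)).toMultilinearMap.map_sum
      (fun j (l : Fin d) => X l j • X l)
    rw [hrow]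
    refine this.trans (Finset.sum_congr rfl fun h _ => ?_)
    exact (detRowAlternating (n := Fin k) (R := ℝ)).toMultilinearMap.map_smul_univ _ _
  rw [h1, ← Finset.sum_filter_of_ne (p := Function.Injective)]
  swap
  · intro h _ hne
    by_contra hni
    exact hne (by rw [rowMinor_eq_zero X hni, mul_zero])
  rw [← Finset.sum_fiberwise_of_maps_to (t := Finset.powersetCard k Finset.univ)
    (g := fun h => Finset.univ.image h)]
  swap
  · intro h hh
    simp [Finset.mem_powersetCard, Finset.card_image_of_injective _ (Finset.mem_filter.mp hh).2]
  refine Finset.sum_congr rfl fun J hJ => ?_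
  obtain ⟨hinj, himg⟩ := hε J hJ
  -- The injective families with image J are the rearrangements of ε J; the Leibniz expansion of one
  -- factor of the square produces exactly their sum.
  have h2 : rowMinor X (ε J) ^ 2 =
      ∑ τ : Perm (Fin k), (∏ j, X (ε J (τ j)) j) * rowMinor X (ε J ∘ τ) := by
    rw [sq]
    nth_rewrite 1 [rowMinor]
    rw [det_apply', Finset.sum_mul]
    refine Finset.sum_congr rfl fun τ _ => ?_
    rw [rowMinor_comp_perm]
    simp only [submatrix_apply, id]
    ring
  rw [h2]
  refine Finset.sum_bij (fun τ _ => ε J ∘ τ) ?_ ?_ ?_ ?_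
  · intro τ _
    simp only [Finset.mem_filter, Finset.mem_univ, true_and]
    refine ⟨hinj.comp τ.injective, ?_⟩
    rw [← Finset.image_image, Finset.image_univ_equiv, himg]
  · intro τ _ τ' _ h
    ext j
    rw [hinj (congrFun h j)]
  · intro h hh
    simp only [Finset.mem_filter, Finset.mem_univ, true_and] at hh
    have hmem : ∀ s, ∃ t, ε J t = h s := fun s => by
      have : h s ∈ Finset.univ.image (ε J) := by rw [himg, ← hh.2]; simp
      simpa using this
    choose τ hτ using hmem
    have hτi : Function.Injective τ := fun x y hxy => hh.1 (by rw [← hτ, ← hτ, hxy])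
    exact ⟨Equiv.ofBijective τ (Finite.injective_iff_bijective.mp hτi), Finset.mem_univ _,
      funext hτ⟩
  · intro τ _
    rfl

theorem card_filter_sdiff_eq {α : Type*} [Fintype α] [DecidableEq α] (I : Finset α) {k i : ℕ}
    (hi : i ≤ k) :
    ((Finset.powersetCard k Finset.univ).filter fun J => (J \ I).card = i).card =
      I.card.choose (k - i) * (Fintype.card α - I.card).choose i := by
  rw [← Finset.card_compl, ← Finset.card_powersetCard, ← Finset.card_powersetCard,
    ← Finset.card_product]
  refine Finset.card_nbij' (fun J => (J ∩ I, J \ I)) (fun p => p.1 ∪ p.2) ?_ ?_ ?_ ?_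
  · intro J hJ
    simp only [Finset.coe_filter, Finset.mem_powersetCard, Set.mem_ofPred_eq] at hJ
    have := Finset.card_inter_add_card_sdiff J I
    simp only [Finset.coe_product, Set.mem_prod, Finset.mem_coe, Finset.mem_powersetCard]
    refine ⟨⟨Finset.inter_subset_right, by omega⟩, ?_, hJ.2⟩
    intro x hx
    simpa using (Finset.mem_sdiff.mp hx).2
  · rintro ⟨P, Q⟩ hp
    simp only [Finset.coe_product, Set.mem_prod, Finset.mem_coe, Finset.mem_powersetCard] at hp
    obtain ⟨⟨hP, hPc⟩, hQ, hQc⟩ := hp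
    have hQI : Disjoint Q I := Finset.subset_compl_iff_disjoint_right.mp hQ
    have hPQ : Disjoint P Q := (hQI.mono_right hP).symm
    simp only [Finset.coe_filter, Finset.mem_powersetCard, Set.mem_ofPred_eq,
      Finset.card_union_of_disjoint hPQ, Finset.union_sdiff_distrib,
      Finset.sdiff_eq_empty_iff_subset.mpr hP, Finset.sdiff_eq_self_of_disjoint hQI,
      Finset.empty_union]
    exact ⟨⟨Finset.subset_univ _, by omega⟩, hQc⟩
  · intro J _
    exact (Finset.union_comm _ _).trans (Finset.sdiff_union_inter J I)
  · rintro ⟨P, Q⟩ hp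
    simp only [Finset.coe_product, Set.mem_prod, Finset.mem_coe, Finset.mem_powersetCard] at hp
    obtain ⟨⟨hP, hPc⟩, hQ, hQc⟩ := hp
    have hQI : Disjoint Q I := Finset.subset_compl_iff_disjoint_right.mp hQ
    simp only [Finset.union_sdiff_distrib, Finset.union_inter_distrib_right,
      Finset.sdiff_eq_empty_iff_subset.mpr hP, Finset.sdiff_eq_self_of_disjoint hQI,
      Finset.inter_eq_left.mpr hP, Finset.disjoint_iff_inter_eq_empty.mp hQI,
      Finset.empty_union, Finset.union_empty]

/-- Two applications of the absorption identity move the denominator from i to k, where it is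
constant in the later sum. -/
theorem choose_div_eq {k i : ℕ} (hi : i ≤ k) :
    (k.choose (k - i) : ℝ) / ((i + 1) * (i + 2)) =
      ((k + 2).choose (k - i) : ℝ) / ((k + 1) * (k + 2)) := by
  have h1 := Nat.add_one_mul_choose_eq k i
  have h2 := Nat.add_one_mul_choose_eq (k + 1) (i + 1)
  have h3 : (k + 2).choose (k - i) = (k + 2).choose (i + 2) := by
    rw [← Nat.choose_symm (show i + 2 ≤ k + 2 by omega)]
    congr 1
    omega
  rw [h3, Nat.choose_symm hi, div_eq_div_iff (by positivity) (by positivity)]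
  have h1' : ((k : ℝ) + 1) * k.choose i = (k + 1).choose (i + 1) * (i + 1) := by exact_mod_cast h1
  have h2' : ((k : ℝ) + 2) * (k + 1).choose (i + 1) = (k + 2).choose (i + 2) * (i + 2) := by
    have := congrArg (Nat.cast : ℕ → ℝ) h2
    push_cast at this
    linarith
  linear_combination ((k : ℝ) + 2) * h1' + ((i : ℝ) + 1) * h2'

theorem sum_powersetCard_inv_sdiff {d k : ℕ} (hk : k ≤ d) (I : Finset (Fin d)) (hI : I.card = k) :
    ∑ J ∈ Finset.powersetCard k Finset.univ,
        (1 : ℝ) / (((J \ I).card + 1) * ((J \ I).card + 2)) =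
      ((d + 2).choose k : ℝ) / ((k + 1) * (k + 2)) := by
  rw [← Finset.sum_fiberwise_of_maps_to (t := Finset.range (k + 1)) (g := fun J => (J \ I).card)]
  swap
  · intro J hJ
    have := Finset.card_le_card (Finset.sdiff_subset (s := J) (t := I))
    rw [(Finset.mem_powersetCard.mp hJ).2] at this
    exact Finset.mem_range.mpr (by omega)
  have hterm : ∀ i ∈ Finset.range (k + 1),
      ∑ J ∈ (Finset.powersetCard k Finset.univ).filter (fun J => (J \ I).card = i),
        (1 : ℝ) / (((J \ I).card + 1) * ((J \ I).card + 2)) =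
      ((k + 2).choose (k - i) * (d - k).choose i : ℕ) / ((k + 1) * (k + 2)) := by
    intro i hi
    have hi : i ≤ k := by simpa [Nat.lt_succ_iff] using hi
    rw [Finset.sum_congr rfl (g := fun _ => (1 : ℝ) / ((i + 1) * (i + 2)))
      (fun J hJ => by rw [(Finset.mem_filter.mp hJ).2]), Finset.sum_const,
      card_filter_sdiff_eq I hi, hI, Fintype.card_fin, nsmul_eq_mul]
    have := choose_div_eq hi
    push_cast
    rw [mul_right_comm, mul_one_div, this]
    ring
  rw [Finset.sum_congr rfl hterm, ← Finset.sum_div, ← Nat.cast_sum]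
  congr 2
  -- Vandermonde's identity for choosing k elements from d - k and k + 2.
  rw [show d + 2 = (d - k) + (k + 2) by omega, Nat.add_choose_eq,
    Finset.Nat.sum_antidiagonal_eq_sum_range_succ_mk]
  exact Finset.sum_congr rfl fun i _ => mul_comm _ _

theorem frame_transpose_mul_frame {d k : ℕ} (hk : k ≤ d) (g : OrthGroup d) :
    (frame hk g)ᵀ * frame hk g = 1 := by
  have h := (mem_orthogonalGroup_iff' (Fin d) ℝ).mp g.2
  have : (frame hk g)ᵀ * frame hk g = (g.1ᵀ * g.1).submatrix (Fin.castLE hk) (Fin.castLE hk) := by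
    ext i j; simp [frame, mul_apply]
  rw [this, h]
  exact submatrix_one _ (Fin.castLE_injective hk)

theorem exists_perm_comp_eq {ι α : Type*} [Fintype α] {f h : ι → α}
    (hf : Function.Injective f) (hh : Function.Injective h) : ∃ σ : Perm α, σ ∘ f = h := by
  classical
  let e : { x // x ∈ Set.range f } ≃ { x // x ∈ Set.range h } :=
    (Equiv.ofInjective f hf).symm.trans (Equiv.ofInjective h hh)
  refine ⟨e.extendSubtype, funext fun j => ?_⟩
  rw [Function.comp_apply, e.extendSubtype_apply_of_mem _ ⟨j, rfl⟩]
  change ((Equiv.ofInjective h hh) ((Equiv.ofInjective f hf).symm _) : α) = h j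
  rw [Equiv.ofInjective_symm_apply hf j]
  rfl

/-- The mean of a squared minor is computed twice: by symmetry among all k-subsets, and by inserting
the sum of all squared minors, which is 1, and applying `minorMoment_eq` to each term. -/
theorem minorMoment_self {d k : ℕ} (hk : k ≤ d) {f : Fin k → Fin d} (hf : Function.Injective f) :
    2 * minorMoment hk f f =
      ((k : ℝ) + 1) * (k + 2) * ((d.choose k : ℝ))⁻¹ * (((d + 2).choose k : ℝ))⁻¹ := by
  have hex : ∀ J : Finset (Fin d), ∃ h : Fin k → Fin d, J ∈ Finset.powersetCard k Finset.univ →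
      Function.Injective h ∧ Finset.univ.image h = J := by
    intro J
    by_cases hJ : J ∈ Finset.powersetCard k Finset.univ
    · have hc := (Finset.mem_powersetCard.mp hJ).2
      refine ⟨J.orderEmbOfFin hc, fun _ => ⟨(J.orderEmbOfFin hc).injective, ?_⟩⟩
      exact J.image_orderEmbOfFin_univ hc
    -- A default value for sets J of the wrong size, which never enter the sums.
    · exact ⟨f, fun h => (hJ h).elim⟩
  choose ε hε using hex
  have hone : ∀ g : OrthGroup d,
      ∑ J ∈ Finset.powersetCard k Finset.univ, rowMinor (frame hk g) (ε J) ^ 2 = 1 := fun g => by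
    rw [sum_rowMinor_sq _ ε hε, frame_transpose_mul_frame, det_one]
  have hcont := fun f => continuous_rowMinor (d := d) (k := k) f
  have hsq : ∀ h : Fin k → Fin d, Function.Injective h →
      frameMean hk (fun X => rowMinor X h ^ 2) = frameMean hk (fun X => rowMinor X f ^ 2) := by
    intro h hh
    obtain ⟨σ, hσ⟩ := exists_perm_comp_eq hf hh
    have := frameMean_mul hk (permMatrix_mem_orthogonalGroup σ) (fun X => rowMinor X f ^ 2)
    simpa only [rowMinor_permMatrix_mul, hσ] using this
  have hmean : (d.choose k : ℝ) * frameMean hk (fun X => rowMinor X f ^ 2) = 1 := by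
    have h1 : frameMean hk (fun X => ∑ J ∈ Finset.powersetCard k Finset.univ,
        rowMinor X (ε J) ^ 2) = 1 := by
      simp [frameMean, hone]
    rw [frameMean_sum _ _ (fun _ _ => by fun_prop),
      Finset.sum_congr rfl (fun J hJ => hsq (ε J) (hε J hJ).1), Finset.sum_const,
      Finset.card_powersetCard, Finset.card_univ, Fintype.card_fin, nsmul_eq_mul] at h1
    exact h1
  have hcard : ∀ J ∈ Finset.powersetCard k Finset.univ,
      (Finset.univ.filter fun t => ε J t ∉ Set.range f).card =
        (J \ Finset.univ.image f).card := by
    intro J hJ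
    obtain ⟨hi, him⟩ := hε J hJ
    rw [← Finset.card_image_of_injective _ hi]
    congr 1
    ext x
    have hx : x ∈ J ↔ x ∈ Finset.univ.image (ε J) := by rw [him]
    simp only [hx, Finset.mem_image, Finset.mem_filter, Finset.mem_univ, true_and, Finset.mem_sdiff,
      Set.mem_range]
    constructor
    · rintro ⟨t, ht, rfl⟩; exact ⟨⟨t, rfl⟩, ht⟩
    · rintro ⟨⟨t, rfl⟩, ht⟩; exact ⟨t, ht, rfl⟩
  have hsum : frameMean hk (fun X => rowMinor X f ^ 2) =
      2 * minorMoment hk f f * (((d + 2).choose k : ℝ) / ((k + 1) * (k + 2))) := by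
    have h1 : frameMean hk (fun X => rowMinor X f ^ 2) =
        frameMean hk (fun X => ∑ J ∈ Finset.powersetCard k Finset.univ,
          rowMinor X f ^ 2 * rowMinor X (ε J) ^ 2) := by
      simp only [frameMean, ← Finset.mul_sum, hone, mul_one]
    rw [h1, frameMean_sum _ _ (fun _ _ => by fun_prop),
      ← sum_powersetCard_inv_sdiff hk (Finset.univ.image f)
        (by rw [Finset.card_image_of_injective _ hf, Finset.card_univ, Fintype.card_fin]),
      Finset.mul_sum]
    refine Finset.sum_congr rfl fun J hJ => ?_
    rw [mul_one_div, ← hcard J hJ]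
    exact minorMoment_eq hk hf (hε J hJ).1
  rw [hsum] at hmean
  have hc1 : (d.choose k : ℝ) ≠ 0 := by exact_mod_cast (Nat.choose_pos hk).ne'
  have hc2 : ((d + 2).choose k : ℝ) ≠ 0 := by
    exact_mod_cast (Nat.choose_pos (show k ≤ d + 2 by omega)).ne'
  have hk1 : (k : ℝ) + 1 ≠ 0 := by positivity
  have hk2 : (k : ℝ) + 2 ≠ 0 := by positivity
  field_simp at hmean ⊢
  linarith

/-! ### The index families of E and F -/

theorem card_shiftEmb_notMem_range {d k i : ℕ} (hik : i ≤ k) (hid : k + i ≤ d) :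
    (Finset.univ.filter fun t => shiftEmb hid t ∉
      Set.range (Fin.castLEEmb (show k ≤ d by omega))).card = i := by
  have : (Finset.univ.filter fun t => shiftEmb hid t ∉
      Set.range (Fin.castLEEmb (show k ≤ d by omega))) =
      -- The shifted positions are the last i ones, k - i, …, k - 1; their values are at least k.
      Finset.univ.image fun j : Fin i => (⟨k - i + j, by omega⟩ : Fin k) := by
    ext t
    have hval : (shiftEmb hid t : ℕ) = if (t : ℕ) + i < k then (t : ℕ) else t + i := by
      change ((if (t : ℕ) + i < k then ⟨t, by omega⟩ else ⟨t + i, by omega⟩ : Fin d) : ℕ) = _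
      split_ifs <;> rfl
    have hmem : shiftEmb hid t ∈ Set.range (Fin.castLEEmb (show k ≤ d by omega)) ↔
        (t : ℕ) + i < k := by
      constructor
      · rintro ⟨j, hj⟩
        by_contra hc
        have := congrArg Fin.val hj
        rw [hval, if_neg hc] at this
        simp at this
        omega
      · intro hc
        exact ⟨t, by ext; rw [hval, if_pos hc]; rfl⟩
    simp only [Finset.mem_filter, Finset.mem_univ, true_and, hmem, Finset.mem_image]
    constructor
    · intro hc
      exact ⟨⟨t - (k - i), by omega⟩, by ext; simp; omega⟩
    · rintro ⟨j, rfl⟩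
      simp; omega
  rw [this, Finset.card_image_of_injective, Finset.card_univ, Fintype.card_fin]
  intro x y hxy
  ext
  simpa using hxy

end

theorem mainTheorem5 (d k i : ℕ) (hk : k < d) (hik : i ≤ k) (hid : k + i ≤ d)
    (e : OrthonormalBasis (Fin d) ℝ (Euc d)) :
    grassConst hid e =
      ((k : ℝ) + 1) * ((k : ℝ) + 2) / (((i : ℝ) + 1) * ((i : ℝ) + 2))
        * ((d.choose k : ℝ))⁻¹ * (((d + 2).choose k : ℝ))⁻¹ := by
  rw [grassConst_eq_minorMoment, minorMoment_eq _ (Function.Embedding.injective _)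
    (Function.Embedding.injective _), card_shiftEmb_notMem_range hik hid,
    minorMoment_self _ (Function.Embedding.injective _)]
  ring
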